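/- Let $X=(X_{ab})_{a,b\ge 1}$ be an infinite matrix of commuting variables, and let $p_k=\operatorname{tr}(X^k)=\sum_{a_1,\dots,a_k\ge 1}X_{a_1a_2}X_{a_2a_3}\cdots X_{a_ka_1}\in\mathbb{C}[[X_{ab}]]_{a,b\ge1}$ for $k\ge 1$. For a positive integer $d$ define the operator on $\mathbb{C}[[X_{ab}]]_{a,b\ge1}$ $$W([d])=\frac1d\,{:}\operatorname{tr}(D^d){:}=\frac1d\sum_{a_1,\dots,a_d\ge1}\ \sum_{e_1,\dots,e_d\ge1}\ \prod_{i=1}^d X_{a_ie_i}\prod_{i=1}^d\frac{\partial}{\partial X_{a_{i+1}e_i}},\qquad a_{d+1}=a_1,$$ the normally ordered trace for the operator matrix $D_{ab}=\sum_{c\ge1}X_{ac}\frac{\partial}{\partial X_{bc}}$ (every coefficient of the result is a finite sum). For $\delta\in S_d$ and positive integers $a_1,\dots,a_d$ put $$\hat p_\delta(a_1,\dots,a_d)=\prod_{c}p_{\sum_{j\in c}a_j},\qquad \frac{\partial}{\partial\hat p_\delta}(a_1,\dots,a_d)=\prod_{c}\Big(\sum_{j\in c}a_j\Big)\frac{\partial}{\partial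 p_{\sum_{j\in c}a_j}},$$ where $c$ runs over all disjoint cycles of $\delta$, including those of length one, and let $$\Delta_d=\frac1d\sum_{\delta\in S_d}\ \sum_{a_1,\dots,a_d\ge1}\hat p_{(d\,\cdots\,2\,1)\delta}(a_1,\dots,a_d)\,\frac{\partial}{\partial\hat p_\delta}(a_1,\dots,a_d)$$ as an operator on the polynomial ring $\mathbb{C}[p_1,p_2,\dots]$ (for each polynomial only finitely many terms contribute). Theorem. The power series $p_1,p_2,\dots$ are algebraically independent over $\mathbb{C}$, so that the polynomial ring $\mathbb{C}[p_1,p_2,\dots]$ is a subring of $\mathbb{C}[[X_{ab}]]_{a,b\ge1}$; and for every positive integer $d$, $W([d])F=\Delta_dF$ for all $F\in\mathbb{C}[p_1,p_2,\dots]$. In particular $W([d])$ maps $\mathbb{C}[p_1,p_2,\dots]$ to itself, and $\Delta_d=W([d])$ as operators on $\mathbb{C}[p_1,p_2,\dots]$. -/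

import Mathlib

namespace WOperator

/-! ### Formal power series in the entries of an infinite variable matrix -/

/-- The ring `ℂ[[X_{ab}]]_{a,b ≥ 1}`: formal power series in the entries of the infinite
variable matrix `X = (X_{ab})`. -/
abbrev MatSeries : Type := MvPowerSeries (ℕ+ × ℕ+) ℂ

/-- The variable `X_{ab}`. -/
noncomputable def entry (a b : ℕ+) : MatSeries := MvPowerSeries.X (a, b)

/-- A possibly infinite family of power series is summable when every monomial occurs in only
finitely many members of the family. -/
def FormallySummable {I : Type*} (f : I → MatSeries) : Prop :=
  ∀ m : ℕ+ × ℕ+ →₀ ℕ, {i | MvPowerSeries.coeff m (f i) ≠ 0}.Finite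

/-- The coefficientwise sum of a (formally summable) family of power series. -/
noncomputable def formalSum {I : Type*} (f : I → MatSeries) : MatSeries :=
  fun m => ∑ᶠ i, MvPowerSeries.coeff m (f i)

theorem coeff_formalSum {I : Type*} (f : I → MatSeries) (m : ℕ+ × ℕ+ →₀ ℕ) :
    MvPowerSeries.coeff m (formalSum f) = ∑ᶠ i, MvPowerSeries.coeff m (f i) := rfl

theorem formalSum_add {I : Type*} {f g : I → MatSeries} (hf : FormallySummable f)
    (hg : FormallySummable g) :
    formalSum (fun i => f i + g i) = formalSum f + formalSum g := by
  ext m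
  simp only [map_add, coeff_formalSum]
  exact finsum_add_distrib (hf m) (hg m)

theorem formalSum_smul {I : Type*} (c : ℂ) (f : I → MatSeries) :
    formalSum (fun i => c • f i) = c • formalSum f := by
  ext m
  simp only [map_smul, coeff_formalSum, smul_eq_mul]
  exact (mul_finsum _ c).symm

theorem coeff_prod_entry_mul_ne_zero {d : ℕ} {a e : Fin d → ℕ+} {F : MatSeries}
    {m : ℕ+ × ℕ+ →₀ ℕ}
    (h : MvPowerSeries.coeff m ((∏ i, entry (a i) (e i)) * F) ≠ 0) (i : Fin d) :
    (a i, e i) ∈ m.support := by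
  rw [Finset.prod_eq_mul_prod_sdiff_singleton_of_mem (Finset.mem_univ i), mul_assoc, entry,
    MvPowerSeries.X, MvPowerSeries.coeff_monomial_mul] at h
  rw [Finsupp.mem_support_iff]
  intro h0
  apply h
  rw [if_neg]
  intro hle
  have := hle (a i, e i)
  simp [h0] at this

/-! ### The power series `p_k = tr(X^k)` -/

/-- The monomial `X_{(a_1,…,a_d)} = X_{a_1 a_2} X_{a_2 a_3} ⋯ X_{a_d a_1}`. Here `finRotate d` is
the cyclic successor `i ↦ i + 1` on indices. -/
noncomputable def cycMonomial {d : ℕ} (a : Fin d → ℕ+) : MatSeries :=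
  ∏ i, entry (a i) (a (finRotate d i))

/-- `p_k = tr(X^k) = ∑_{a_1,…,a_k ≥ 1} X_{a_1 a_2} X_{a_2 a_3} ⋯ X_{a_k a_1}`. -/
noncomputable def powerTrace (k : ℕ+) : MatSeries :=
  formalSum fun a : Fin (k : ℕ) → ℕ+ => cycMonomial a

theorem formallySummable_cycMonomial (d : ℕ) :
    FormallySummable fun a : Fin d → ℕ+ => cycMonomial a := by
  intro m
  refine (Set.Finite.pi' (fun _ : Fin d =>
    (m.support.image Prod.fst).finite_toSet)).subset ?_
  intro a ha i
  have h : MvPowerSeries.coeff m ((∏ i, entry (a i) (a (finRotate d i))) * (1 : MatSeries)) ≠ 0 := by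
    rw [mul_one]; exact ha
  exact Finset.mem_coe.2 (Finset.mem_image_of_mem Prod.fst (coeff_prod_entry_mul_ne_zero h i))

/-! ### The operator `W([d])` -/

/-- The partial derivative `∂/∂X_{ab}` as a linear operator on power series. -/
noncomputable def dEntry (a b : ℕ+) : Module.End ℂ MatSeries :=
  (MvPowerSeries.pderiv ℂ (a, b)).toLinearMap

theorem dEntry_commute (a b a' b' : ℕ+) : Commute (dEntry a b) (dEntry a' b') := by
  refine LinearMap.ext fun F => ?_
  ext m
  change MvPowerSeries.coeff m (MvPowerSeries.pderiv ℂ (a, b) (MvPowerSeries.pderiv ℂ (a', b') F))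
    = MvPowerSeries.coeff m (MvPowerSeries.pderiv ℂ (a', b') (MvPowerSeries.pderiv ℂ (a, b) F))
  simp only [MvPowerSeries.coeff_pderiv]
  by_cases h : (a, b) = (a', b')
  · rw [h]
  · rw [add_right_comm m]
    simp [h, Ne.symm h]
    ring

theorem dEntry_pairwise {d : ℕ} (b e : Fin d → ℕ+) :
    ((Finset.univ : Finset (Fin d)) : Set (Fin d)).Pairwise
      (Function.onFun Commute fun i => dEntry (b i) (e i)) :=
  fun _ _ _ _ _ => dEntry_commute _ _ _ _

/-- The product of commuting operators `∏_i ∂/∂X_{b_i e_i}`. -/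
noncomputable def dEntries {d : ℕ} (b e : Fin d → ℕ+) : Module.End ℂ MatSeries :=
  Finset.univ.noncommProd (fun i => dEntry (b i) (e i)) (dEntry_pairwise b e)

theorem formallySummable_normalOrdered {d : ℕ} (a b : Fin d → ℕ+) (F : MatSeries) :
    FormallySummable fun e : Fin d → ℕ+ => (∏ i, entry (a i) (e i)) * dEntries b e F := by
  intro m
  refine (Set.Finite.pi' (fun _ : Fin d =>
    (m.support.image Prod.snd).finite_toSet)).subset ?_
  intro e he i
  exact Finset.mem_coe.2 (Finset.mem_image_of_mem Prod.snd (coeff_prod_entry_mul_ne_zero he i))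

/-- The normal ordered product
`:∏_i D_{a_i b_i}: = ∑_{e_1,…,e_d ≥ 1} ∏_i X_{a_i e_i} ∏_i ∂/∂X_{b_i e_i}`, where
`D_{ab} = ∑_{c ≥ 1} X_{ac} ∂/∂X_{bc}`. -/
noncomputable def normalOrdered {d : ℕ} (a b : Fin d → ℕ+) : Module.End ℂ MatSeries where
  toFun F := formalSum fun e : Fin d → ℕ+ => (∏ i, entry (a i) (e i)) * dEntries b e F
  map_add' F G := by
    simp only [map_add, mul_add]
    exact formalSum_add (formallySummable_normalOrdered a b F)
      (formallySummable_normalOrdered a b G)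
  map_smul' c F := by
    simp only [map_smul, mul_smul_comm, RingHom.id_apply]
    exact formalSum_smul c _

/-- `D_{(a_1,…,a_d)} = :D_{a_1 a_2} D_{a_2 a_3} ⋯ D_{a_d a_1}:`. -/
noncomputable def cycD {d : ℕ} (a : Fin d → ℕ+) : Module.End ℂ MatSeries :=
  normalOrdered a (fun i => a (finRotate d i))

theorem formallySummable_cycD (d : ℕ) (F : MatSeries) :
    FormallySummable fun a : Fin d → ℕ+ => cycD a F := by
  intro m
  refine (Set.Finite.pi' (fun _ : Fin d =>
    (m.support.image Prod.fst).finite_toSet)).subset ?_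
  intro a ha i
  obtain ⟨e, he⟩ : ∃ e : Fin d → ℕ+, MvPowerSeries.coeff m ((∏ i, entry (a i) (e i)) *
      dEntries (fun i => a (finRotate d i)) e F) ≠ 0 := by
    by_contra! hall
    exact ha ((finsum_congr hall).trans finsum_zero)
  exact Finset.mem_coe.2 (Finset.mem_image_of_mem Prod.fst (coeff_prod_entry_mul_ne_zero he i))

/-- The operator `W([d]) = (1/d) :tr(D^d): = (1/d) ∑_{a_1,…,a_d ≥ 1} D_{(a_1,…,a_d)}` on
`ℂ[[X_{ab}]]`. -/
noncomputable def W (d : ℕ) : Module.End ℂ MatSeries where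
  toFun F := (d : ℂ)⁻¹ • formalSum fun a : Fin d → ℕ+ => cycD a F
  map_add' F G := by
    simp only [map_add]
    rw [formalSum_add (formallySummable_cycD d F) (formallySummable_cycD d G), smul_add]
  map_smul' c F := by
    simp only [map_smul, RingHom.id_apply]
    rw [formalSum_smul, smul_comm]

/-! ### The operator `Δ_d` on `ℂ[p_1, p_2, …]` -/

/-- The polynomial ring `ℂ[p_1, p_2, …]`. -/
abbrev PRing : Type := MvPolynomial ℕ+ ℂ

/-- The cycles of a permutation `δ ∈ S_d`, cycles of length one included: the classes of
"lying in the same cycle of `δ`". -/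
abbrev Cycles {d : ℕ} (δ : Equiv.Perm (Fin d)) : Type :=
  Quotient (Equiv.Perm.SameCycle.setoid δ)

open Classical in
/-- The positive integer `∑_{j ∈ c} a_j` for a cycle `c` of `δ`. -/
noncomputable def cycleSum {d : ℕ} (δ : Equiv.Perm (Fin d)) (a : Fin d → ℕ+) (c : Cycles δ) : ℕ+ :=
  ⟨∑ j with (Quotient.mk _ j : Cycles δ) = c, (a j : ℕ), by
    induction c using Quotient.inductionOn with
    | _ j => exact Finset.sum_pos (fun i _ => (a i).pos) ⟨j, by simp⟩⟩

open Classical in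
/-- `p̂_δ(a_1,…,a_d) = ∏_c p_{∑_{j ∈ c} a_j}`, the product over all cycles `c` of `δ`. -/
noncomputable def pHat {d : ℕ} (δ : Equiv.Perm (Fin d)) (a : Fin d → ℕ+) : PRing :=
  ∏ c : Cycles δ, MvPolynomial.X (cycleSum δ a c)

/-- The operator `n ∂/∂p_n` on `ℂ[p_1, p_2, …]`. -/
noncomputable def scaledD (n : ℕ+) : Module.End ℂ PRing :=
  ((n : ℕ) : ℂ) • (MvPolynomial.pderiv n).toLinearMap

theorem scaledD_commute (n k : ℕ+) : Commute (scaledD n) (scaledD k) := by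
  have h : ⁅(MvPolynomial.pderiv n : Derivation ℂ PRing PRing),
      (MvPolynomial.pderiv k : Derivation ℂ PRing PRing)⁆ = 0 := by
    apply MvPolynomial.derivation_ext
    intro i
    classical
    simp only [Derivation.commutator_apply, MvPolynomial.pderiv_X, Derivation.coe_zero,
      Pi.zero_apply, Pi.single_apply]
    split_ifs <;> simp
  have h' : Commute (MvPolynomial.pderiv n : Derivation ℂ PRing PRing).toLinearMap
      (MvPolynomial.pderiv k : Derivation ℂ PRing PRing).toLinearMap := by
    refine LinearMap.ext fun F => ?_
    have := DFunLike.congr_fun h F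
    rw [Derivation.commutator_apply] at this
    exact sub_eq_zero.1 this
  exact (h'.smul_left _).smul_right _

open Classical in
theorem scaledD_pairwise {d : ℕ} (δ : Equiv.Perm (Fin d)) (a : Fin d → ℕ+) :
    ((Finset.univ : Finset (Cycles δ)) : Set (Cycles δ)).Pairwise
      (Function.onFun Commute fun c => scaledD (cycleSum δ a c)) :=
  fun _ _ _ _ _ => scaledD_commute _ _

open Classical in
/-- `∂/∂p̂_δ(a_1,…,a_d) = ∏_c (∑_{j ∈ c} a_j) ∂/∂p_{∑_{j ∈ c} a_j}`, the product of commuting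
operators over all cycles `c` of `δ`. -/
noncomputable def dHat {d : ℕ} (δ : Equiv.Perm (Fin d)) (a : Fin d → ℕ+) : Module.End ℂ PRing :=
  Finset.univ.noncommProd (fun c : Cycles δ => scaledD (cycleSum δ a c)) (scaledD_pairwise δ a)

/-- The bijection `φ_d : S_d → S_d`, `φ_d(δ) = (d … 2 1) δ`. The cycle `(d … 2 1)` sends
`i + 1` to `i`, so it is the inverse of `finRotate d`. -/
def phi {d : ℕ} (δ : Equiv.Perm (Fin d)) : Equiv.Perm (Fin d) :=
  (finRotate d)⁻¹ * δ

/-- For every polynomial `F`, only finitely many `(a_1,…,a_d)` contribute to `Δ_d F`. -/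
theorem finite_dHat_ne_zero {d : ℕ} (δ : Equiv.Perm (Fin d)) (F : PRing) :
    {a : Fin d → ℕ+ | dHat δ a F ≠ 0}.Finite := by
  classical
  refine (Set.Finite.pi' (fun _ : Fin d =>
    (Finset.Iic (F.vars.sup id)).finite_toSet)).subset ?_
  intro a ha i
  set c : Cycles δ := Quotient.mk _ i with hc
  have hmem : cycleSum δ a c ∈ F.vars := by
    by_contra hnot
    apply ha
    have h0 : scaledD (cycleSum δ a c) F = 0 := by
      simp [scaledD, MvPolynomial.pderiv_eq_zero_of_notMem_vars hnot]
    rw [dHat, ← Finset.noncommProd_erase_mul _ (Finset.mem_univ c), Module.End.mul_apply, h0,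
      map_zero]
  have hle : a i ≤ cycleSum δ a c := by
    rw [← PNat.coe_le_coe]
    change (a i : ℕ) ≤ ∑ j with (Quotient.mk _ j : Cycles δ) = c, (a j : ℕ)
    exact Finset.single_le_sum (f := fun j => (a j : ℕ)) (fun _ _ => Nat.zero_le _)
      (Finset.mem_filter.2 ⟨Finset.mem_univ i, hc.symm⟩)
  exact Finset.mem_coe.2 (Finset.mem_Iic.2 (hle.trans (Finset.le_sup (f := id) hmem)))

theorem finite_pHat_mul_dHat_ne_zero {d : ℕ} (δ : Equiv.Perm (Fin d)) (F : PRing) :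
    (Function.support fun a : Fin d → ℕ+ => pHat (phi δ) a * dHat δ a F).Finite :=
  (finite_dHat_ne_zero δ F).subset fun _ ha h0 => ha (by simp only [h0, mul_zero])

/-- The operator
`Δ_d = (1/d) ∑_{δ ∈ S_d} ∑_{a_1,…,a_d ≥ 1} p̂_{φ_d(δ)}(a_1,…,a_d) ∂/∂p̂_δ(a_1,…,a_d)`
on `ℂ[p_1, p_2, …]`. -/
noncomputable def Delta (d : ℕ) : Module.End ℂ PRing where
  toFun F := (d : ℂ)⁻¹ • ∑ δ : Equiv.Perm (Fin d),
    ∑ᶠ a : Fin d → ℕ+, pHat (phi δ) a * dHat δ a F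
  map_add' F G := by
    rw [← smul_add, ← Finset.sum_add_distrib]
    congr 1
    refine Finset.sum_congr rfl fun δ _ => ?_
    rw [← finsum_add_distrib (finite_pHat_mul_dHat_ne_zero δ F)
      (finite_pHat_mul_dHat_ne_zero δ G)]
    simp only [map_add, mul_add]
  map_smul' c F := by
    rw [RingHom.id_apply, smul_comm c]
    congr 1
    rw [Finset.smul_sum]
    refine Finset.sum_congr rfl fun δ _ => ?_
    simp only [map_smul, mul_smul_comm]
    exact (smul_finsum c fun a : Fin d → ℕ+ => pHat (phi δ) a * dHat δ a F).symm

/-- The algebra homomorphism `ℂ[p_1, p_2, …] → ℂ[[X_{ab}]]`, `F ↦ F(tr X, tr X², …)`. -/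
noncomputable def toSeries : PRing →ₐ[ℂ] MatSeries :=
  MvPolynomial.aeval powerTrace

end WOperator

/-! For a matrix `M` of independent variables over a finite index set, let D_{be} be differentiation
by the entry M_{be} and E_{be} the matrix unit. Then D_{be} M^n = ∑_k M^k E_{be} M^(n-1-k), hence
D_{be} tr M^n = n (M^(n-1))_{eb}. Thus, when a polynomial in traces is differentiated repeatedly,
each new derivative either strikes the polynomial and creates a new matrix entry, or cuts an
existing entry in two. Let a permutation record which e is paired with which b: the first case adds
a fixed point, the second inserts a point into a cycle. This is how S_{d+1} arises from S_d under
`decomposeFin`, so d derivatives yield a sum over δ ∈ S_d (`prod_derivation_evalTrace`). Cutting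
preserves the sum of the a_i over a cycle, so the operator ∂/∂p̂_δ emerges. Multiplying by the
X_{a_i e_i} and summing over the indices glues the entries into traces along the cycles of (d … 2
1)δ (`sum_sum_prod_eq_prod_trace`).

The infinite matrix is reduced to finite ones by setting the variables outside T × T to zero; a
series is determined by these restrictions (`eq_of_forall_restrict_eq`), and the restriction of W is
a finite sum (`restrict_W`).

For algebraic independence, restriction to finite diagonal matrices turns traces into power sums.
Differentiating a relation by each X_{ii} gives a polynomial with too many roots, so every partial
derivative is again a relation (`evalPsum_scaledD_eq_zero`); induction on degree kills all
coefficients. -/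

namespace WOperator

open Equiv.Perm (decomposeFin)

/-! ### Cycle sums of a permutation -/

open Classical in
/-- The multiset of the numbers `∑_{j ∈ c} a_j`, where `c` runs over the cycles of `δ`. -/
noncomputable def cycleSums {d : ℕ} (δ : Equiv.Perm (Fin d)) (a : Fin d → ℕ+) : Multiset ℕ+ :=
  (Finset.univ : Finset (Cycles δ)).val.map (cycleSum δ a)

theorem pHat_eq_prod_cycleSums {d : ℕ} (δ : Equiv.Perm (Fin d)) (a : Fin d → ℕ+) :
    pHat δ a = ((cycleSums δ a).map MvPolynomial.X).prod := by
  rw [cycleSums, Multiset.map_map]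
  rfl

/-- The product of the commuting operators `n ∂/∂p_n` over a multiset of indices `n`. -/
noncomputable def scaledDs (s : Multiset ℕ+) : Module.End ℂ PRing :=
  (s.map scaledD).noncommProd (by
    rintro x hx y hy -
    obtain ⟨n, -, rfl⟩ := Multiset.mem_map.1 hx
    obtain ⟨k, -, rfl⟩ := Multiset.mem_map.1 hy
    exact scaledD_commute n k)

@[simp]
theorem scaledDs_zero : scaledDs 0 = 1 := by
  simp [scaledDs]

@[simp]
theorem scaledDs_cons (n : ℕ+) (s : Multiset ℕ+) :
    scaledDs (n ::ₘ s) = scaledD n * scaledDs s := by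
  simp [scaledDs]

/-- The multiset form allows operators attached to permutations of different degrees to be compared.
-/
theorem dHat_eq_scaledDs {d : ℕ} (δ : Equiv.Perm (Fin d)) (a : Fin d → ℕ+) :
    dHat δ a = scaledDs (cycleSums δ a) := by
  simp [dHat, scaledDs, cycleSums, Finset.noncommProd]

theorem mk_apply_eq {d : ℕ} (δ : Equiv.Perm (Fin d)) (j : Fin d) :
    (Quotient.mk _ (δ j) : Cycles δ) = Quotient.mk _ j :=
  Quotient.sound (show δ.SameCycle (δ j) j from Equiv.Perm.sameCycle_apply_left.2 (.refl _ _))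

/-- A function that is invariant under `δ` descends to the cycles of `δ`. -/
def cyclesLift {d : ℕ} {δ : Equiv.Perm (Fin d)} {β : Type*} (g : Fin d → β)
    (hg : ∀ j, g (δ j) = g j) : Cycles δ → β :=
  Quotient.lift g (by
    rintro x _ ⟨n, rfl⟩
    have h1 : ∀ (n : ℕ) x, g ((δ ^ n) x) = g x := by
      intro n
      induction n with
      | zero => simp
      | succ n ih => intro x; rw [pow_succ, Equiv.Perm.mul_apply, ih, hg]
    cases n with
    | ofNat n => exact (h1 n x).symm
    | negSucc n =>
      have := h1 (n + 1) ((δ ^ (Int.negSucc n)) x)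
      rw [← this, ← zpow_natCast, ← Equiv.Perm.mul_apply, ← zpow_add]
      congr 1
      simp [Int.negSucc_eq])

open Classical in
theorem coe_cycleSum {d : ℕ} (δ : Equiv.Perm (Fin d)) (a : Fin d → ℕ+) (c : Cycles δ) :
    (cycleSum δ a c : ℕ) = ∑ j, if (Quotient.mk _ j : Cycles δ) = c then (a j : ℕ) else 0 := by
  rw [← Finset.sum_filter]; rfl

@[simp]
theorem cycleSums_zero (δ : Equiv.Perm (Fin 0)) (a : Fin 0 → ℕ+) : cycleSums δ a = 0 := by
  classical
  have : IsEmpty (Cycles δ) := ⟨fun c => Quotient.inductionOn c fun j => j.elim0⟩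
  simp [cycleSums]

theorem decomposeFin_symm_zero_succ {d : ℕ} (e : Equiv.Perm (Fin d)) (j : Fin d) :
    decomposeFin.symm (0, e) j.succ = (e j).succ := by
  simp

theorem decomposeFin_symm_succ_self {d : ℕ} (e : Equiv.Perm (Fin d)) (i : Fin d) :
    decomposeFin.symm ((e i).succ, e) i.succ = 0 := by
  simp

theorem decomposeFin_symm_succ_of_ne {d : ℕ} (e : Equiv.Perm (Fin d)) {i j : Fin d}
    (h : j ≠ i) : decomposeFin.symm ((e i).succ, e) j.succ = (e j).succ := by
  rw [Equiv.Perm.decomposeFin_symm_apply_succ, Equiv.swap_apply_of_ne_of_ne (Fin.succ_ne_zero _)]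
  simpa using h

/-- Adding a fixed point to a permutation adds a cycle. -/
def cyclesDecomposeFinZero {d : ℕ} (e : Equiv.Perm (Fin d)) :
    Cycles (decomposeFin.symm (0, e)) ≃ Option (Cycles e) where
  toFun := cyclesLift (Fin.cases none fun j => some (Quotient.mk _ j)) (by
    intro j
    cases j using Fin.cases with
    | zero => simp
    | succ j => rw [decomposeFin_symm_zero_succ, Fin.cases_succ, Fin.cases_succ, mk_apply_eq])
  invFun := fun o => o.elim (Quotient.mk _ 0) (cyclesLift (fun j => Quotient.mk _ j.succ) (by
    intro j
    rw [← decomposeFin_symm_zero_succ, mk_apply_eq]))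
  left_inv := by
    intro c
    induction c using Quotient.inductionOn with
    | _ j => cases j using Fin.cases <;> rfl
  right_inv := by
    rintro (_ | c)
    · rfl
    · induction c using Quotient.inductionOn with
      | _ j => rfl

/-- The point 0 is a cycle by itself and the other cycles are those of `e`. -/
theorem cycleSums_decomposeFin_zero {d : ℕ} (e : Equiv.Perm (Fin d)) (x : ℕ+) (a : Fin d → ℕ+) :
    cycleSums (decomposeFin.symm (0, e)) (Fin.cons x a) = x ::ₘ cycleSums e a := by
  classical
  have h1 : (Finset.univ : Finset (Cycles (decomposeFin.symm (0, e)))).val.map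
      (cycleSum _ (Fin.cons x a)) = (Finset.univ : Finset (Option (Cycles e))).val.map
        (fun o => o.elim x (cycleSum e a)) := by
    rw [← Multiset.map_univ_val_equiv (cyclesDecomposeFinZero e), Multiset.map_map]
    refine Multiset.map_congr rfl fun c _ => ?_
    induction c using Quotient.inductionOn with
    | _ k =>
    apply PNat.eq
    -- Membership in a cycle is tested in `Option (Cycles e)`, where `none` is the cycle of 0.
    have key : ∀ j : Fin (d + 1), ((Quotient.mk _ j : Cycles (decomposeFin.symm (0, e))) =
        Quotient.mk _ k) ↔ cyclesDecomposeFinZero e (Quotient.mk _ j) =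
          cyclesDecomposeFinZero e (Quotient.mk _ k) := fun j => (Equiv.apply_eq_iff_eq _).symm
    rw [coe_cycleSum]
    simp only [key, Fin.sum_univ_succ]
    cases k using Fin.cases with
    | zero =>
      have h0 : cyclesDecomposeFinZero e (Quotient.mk _ 0) = none := rfl
      have hs : ∀ j : Fin d, cyclesDecomposeFinZero e (Quotient.mk _ j.succ) =
        some (Quotient.mk _ j) := fun _ => rfl
      simp [h0, hs]
    | succ k =>
      have h0 : cyclesDecomposeFinZero e (Quotient.mk _ 0) = none := rfl
      have hs : ∀ j : Fin d, cyclesDecomposeFinZero e (Quotient.mk _ j.succ) =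
        some (Quotient.mk _ j) := fun _ => rfl
      simp only [h0, hs, Function.comp, Option.elim, coe_cycleSum]
      simp
  rw [cycleSums, cycleSums]
  convert h1 using 1
  simp [univ_option, Finset.insertNone]
  rfl

/-- Inserting a point next to `i` into a cycle does not change the number of cycles. -/
def cyclesDecomposeFinSucc {d : ℕ} (e : Equiv.Perm (Fin d)) (i : Fin d) :
    Cycles (decomposeFin.symm ((e i).succ, e)) ≃ Cycles e where
  toFun := cyclesLift (Fin.cases (Quotient.mk _ i) fun j => Quotient.mk _ j) (by
    intro j
    cases j using Fin.cases with
    | zero =>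
      rw [Equiv.Perm.decomposeFin_symm_apply_zero, Fin.cases_succ, Fin.cases_zero, mk_apply_eq]
    | succ j =>
      by_cases h : j = i
      · subst h
        rw [decomposeFin_symm_succ_self, Fin.cases_succ, Fin.cases_zero]
      · rw [decomposeFin_symm_succ_of_ne e h, Fin.cases_succ, Fin.cases_succ, mk_apply_eq])
  invFun := cyclesLift (fun j => Quotient.mk _ j.succ) (by
    intro j
    by_cases h : j = i
    · subst h
      have h1 := mk_apply_eq (decomposeFin.symm ((e j).succ, e)) 0
      have h2 := mk_apply_eq (decomposeFin.symm ((e j).succ, e)) j.succ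
      rw [Equiv.Perm.decomposeFin_symm_apply_zero] at h1
      rw [decomposeFin_symm_succ_self] at h2
      exact h1.trans h2
    · have h1 := mk_apply_eq (decomposeFin.symm ((e i).succ, e)) j.succ
      rwa [decomposeFin_symm_succ_of_ne e h] at h1)
  left_inv := by
    intro c
    induction c using Quotient.inductionOn with
    | _ j =>
      cases j using Fin.cases with
      | zero =>
        change (Quotient.mk _ i.succ : Cycles (decomposeFin.symm ((e i).succ, e))) =
          Quotient.mk _ 0
        have h2 := mk_apply_eq (decomposeFin.symm ((e i).succ, e)) i.succ
        rw [decomposeFin_symm_succ_self] at h2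
        exact h2.symm
      | succ j => rfl
  right_inv := by
    intro c
    induction c using Quotient.inductionOn with
    | _ j => rfl

/-- The new permutation sends `i` to the new point 0 and 0 to `e i`, so the weight `x` of 0 is
counted exactly when that of `i` is, and can be merged into it. -/
theorem cycleSums_decomposeFin_succ {d : ℕ} (e : Equiv.Perm (Fin d)) (i : Fin d) (x : ℕ+)
    (a : Fin d → ℕ+) : cycleSums (decomposeFin.symm ((e i).succ, e)) (Fin.cons x a) =
      cycleSums e (Function.update a i (x + a i)) := by
  classical
  rw [cycleSums, cycleSums, ← Multiset.map_univ_val_equiv (cyclesDecomposeFinSucc e i),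
    Multiset.map_map]
  refine Multiset.map_congr rfl fun c _ => ?_
  apply PNat.eq
  rw [Function.comp, coe_cycleSum, coe_cycleSum, Fin.sum_univ_succ]
  have key : ∀ j : Fin (d + 1), ((Quotient.mk _ j : Cycles (decomposeFin.symm ((e i).succ, e))) =
      c) ↔ cyclesDecomposeFinSucc e i (Quotient.mk _ j) = cyclesDecomposeFinSucc e i c :=
    fun j => (Equiv.apply_eq_iff_eq _).symm
  have h0 : cyclesDecomposeFinSucc e i (Quotient.mk _ 0) = Quotient.mk _ i := rfl
  have hs : ∀ j : Fin d, cyclesDecomposeFinSucc e i (Quotient.mk _ j.succ) =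
    Quotient.mk _ j := fun _ => rfl
  simp only [key, h0, hs, Fin.cons_zero, Fin.cons_succ]
  rw [← Finset.add_sum_erase _ _ (Finset.mem_univ i),
    ← Finset.add_sum_erase (a := i) _ _ (Finset.mem_univ i), ← add_assoc]
  congr 1
  · rw [Function.update_self]
    split_ifs <;> simp
  · refine Finset.sum_congr rfl fun j hj => ?_
    rw [Function.update_of_ne (Finset.ne_of_mem_erase hj)]

/-- A sum over `S_{d+1}`, organised by removing the first point from its cycle. -/
theorem sum_perm_fin_succ {d : ℕ} {M : Type*} [AddCommMonoid M]
    (f : Equiv.Perm (Fin (d + 1)) → M) :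
    ∑ δ, f δ = ∑ e : Equiv.Perm (Fin d),
      (f (decomposeFin.symm (0, e)) + ∑ i, f (decomposeFin.symm ((e i).succ, e))) := by
  rw [← Equiv.sum_comp decomposeFin.symm, Fintype.sum_prod_type_right]
  refine Finset.sum_congr rfl fun e _ => ?_
  rw [Fin.sum_univ_succ]
  congr 1
  exact (Equiv.sum_comp e fun j => f (decomposeFin.symm (j.succ, e))).symm

/-- Every permutation of `Fin (d + 1)` arises by adding a fixed point to a permutation of `Fin d`
or by inserting a point into one of its cycles. -/
theorem exists_eq_decomposeFin_symm {d : ℕ} (δ : Equiv.Perm (Fin (d + 1))) :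
    ∃ e : Equiv.Perm (Fin d), δ = decomposeFin.symm (0, e) ∨
      ∃ i, δ = decomposeFin.symm ((e i).succ, e) := by
  obtain ⟨⟨p, e⟩, rfl⟩ := decomposeFin.symm.surjective δ
  refine ⟨e, ?_⟩
  cases p using Fin.cases with
  | zero => exact Or.inl rfl
  | succ j => exact Or.inr ⟨e.symm j, by simp⟩

end WOperator

namespace WOperator

open Equiv.Perm (decomposeFin)

/-! ### Matrix powers, traces and their derivatives -/

section Matrices

variable {R T : Type*} [CommRing R] [Fintype T]

theorem sum_fin_succ_pi {d : ℕ} {M : Type*} [AddCommMonoid M] (f : (Fin (d + 1) → T) → M) :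
    ∑ α, f α = ∑ x : T, ∑ α : Fin d → T, f (Fin.cons x α) := by
  rw [← (Fin.consEquiv fun _ => T).sum_comp, Fintype.sum_prod_type]
  rfl

/-- A sum over a tuple of indices, one for each factor, of a product is a product of sums. -/
theorem sum_pi_prod {d : ℕ} (σ : Equiv.Perm (Fin d)) (g : Fin d → T → R) :
    ∑ e : Fin d → T, ∏ i, g i (e (σ i)) = ∏ i, ∑ x, g i x := by
  rw [Finset.prod_univ_sum, Fintype.piFinset_univ]
  exact (Equiv.sum_comp (Equiv.arrowCongr σ.symm (Equiv.refl T)) fun e => ∏ i, g i (e i))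

variable [DecidableEq T]

/-- The trace of powers of a matrix along the cycles of a permutation. -/
theorem sum_prod_pow_eq_prod_trace (M : Matrix T T R) {d : ℕ} (σ : Equiv.Perm (Fin d))
    (a : Fin d → ℕ+) :
    ∑ α : Fin d → T, ∏ i, (M ^ (a i : ℕ)) (α (σ i)) (α i) =
      ((cycleSums σ a).map fun k : ℕ+ => (M ^ (k : ℕ)).trace).prod := by
  induction d with
  | zero => simp
  | succ d ih =>
    obtain ⟨e, he⟩ := exists_eq_decomposeFin_symm σ
    obtain ⟨x, a, rfl⟩ : ∃ x b, a = Fin.cons x b := ⟨a 0, Fin.tail a, (Fin.cons_self_tail a).symm⟩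
    rw [sum_fin_succ_pi]
    simp only [Fin.prod_univ_succ, Fin.cons_zero, Fin.cons_succ]
    rcases he with rfl | ⟨i, rfl⟩
    · rw [cycleSums_decomposeFin_zero, Multiset.map_cons, Multiset.prod_cons, ← ih]
      simp only [Equiv.Perm.decomposeFin_symm_apply_zero, Fin.cons_zero,
        decomposeFin_symm_zero_succ, Fin.cons_succ]
      rw [Matrix.trace, Finset.sum_mul_sum]
      rfl
    -- The index of the inserted point occurs in only two factors; summing over it multiplies M^x by
    -- M^(a i).
    · rw [cycleSums_decomposeFin_succ, ← ih, Finset.sum_comm]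
      refine Finset.sum_congr rfl fun α _ => ?_
      rw [← Finset.mul_prod_erase _ _ (Finset.mem_univ i), Function.update_self,
        PNat.add_coe, pow_add, Matrix.mul_apply, Finset.sum_mul]
      refine Finset.sum_congr rfl fun y _ => ?_
      rw [← Finset.mul_prod_erase _ _ (Finset.mem_univ i), decomposeFin_symm_succ_self,
        Equiv.Perm.decomposeFin_symm_apply_zero, Fin.cons_succ, Fin.cons_zero, mul_assoc]
      congr 2
      refine Finset.prod_congr rfl fun j hj => ?_
      have hj := Finset.ne_of_mem_erase hj
      rw [decomposeFin_symm_succ_of_ne e hj, Fin.cons_succ, Function.update_of_ne hj]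

/-- The contraction of the indices in the normally ordered trace. -/
theorem sum_sum_prod_eq_prod_trace (M : Matrix T T R) {d : ℕ} (δ : Equiv.Perm (Fin d))
    (a : Fin d → ℕ+) :
    ∑ α : Fin d → T, ∑ e : Fin d → T, (∏ i, M (α i) (e i)) *
        ∏ i, (M ^ (a i - 1 : ℕ)) (e (δ i)) (α (finRotate d i)) =
      ((cycleSums (phi δ) a).map fun k : ℕ+ => (M ^ (k : ℕ)).trace).prod := by
  rw [← sum_prod_pow_eq_prod_trace,
    ← Equiv.sum_comp (Equiv.arrowCongr (finRotate d) (Equiv.refl T))]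
  refine Finset.sum_congr rfl fun β _ => ?_
  obtain ⟨α, hα⟩ : ∃ α, α = Equiv.arrowCongr (finRotate d) (Equiv.refl T) β := ⟨_, rfl⟩
  rw [← hα]
  -- Reordering the first product by `δ` makes each `e (δ i)` occur in a single factor, so the sum
  -- over `e` factorises and raises the exponent to `a i`.
  have h : ∀ e : Fin d → T, (∏ i, M (α i) (e i)) *
      ∏ i, (M ^ (a i - 1 : ℕ)) (e (δ i)) (α (finRotate d i)) =
      ∏ i, M (α (δ i)) (e (δ i)) * (M ^ (a i - 1 : ℕ)) (e (δ i)) (α (finRotate d i)) := fun e => by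
    rw [Finset.prod_mul_distrib, Equiv.prod_comp δ fun i => M (α i) (e i)]
  rw [Finset.sum_congr rfl fun e _ => h e, sum_pi_prod δ fun i x =>
    M (α (δ i)) x * (M ^ (a i - 1 : ℕ)) x (α (finRotate d i))]
  refine Finset.prod_congr rfl fun i _ => ?_
  rw [← Matrix.mul_apply, ← pow_succ', Nat.sub_add_cancel (a i).pos]
  have hc : α (finRotate d i) = β i := by
    rw [hα]
    exact congrArg β ((finRotate d).symm_apply_apply i)
  rw [hc, hα]
  rfl

/-- The derivative of the power of a matrix whose entries are derived to matrix units. -/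
theorem derivation_pow_apply [Algebra ℂ R] (D : Derivation ℂ R R) (M : Matrix T T R) (b e : T)
    (hD : ∀ x y, D (M x y) = if x = b ∧ y = e then 1 else 0) (n : ℕ) (x y : T) :
    D ((M ^ n) x y) = ∑ k ∈ Finset.range n, (M ^ k) x b * (M ^ (n - 1 - k)) e y := by
  induction n generalizing y with
  | zero => by_cases h : x = y <;> simp [h]
  | succ n ih =>
    rw [pow_succ, Matrix.mul_apply, map_sum]
    simp only [Derivation.leibniz, ih, hD, smul_eq_mul, Finset.sum_add_distrib]
    -- The summand `k = n` comes from differentiating the last factor of M^n * M; the others come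
    -- from M^n.
    rw [Finset.sum_range_succ, add_comm]
    congr 1
    · simp only [Finset.mul_sum]
      rw [Finset.sum_comm]
      refine Finset.sum_congr rfl fun k hk => ?_
      have : n + 1 - 1 - k = (n - 1 - k) + 1 := by have := Finset.mem_range.1 hk; omega
      rw [this, pow_succ, Matrix.mul_apply, Finset.mul_sum]
      exact Finset.sum_congr rfl fun z _ => by ring
    · by_cases h : y = e
      · simp [h]
      · simp [h, Ne.symm h]

/-- By cyclicity of the trace, the n places where the derivative can act contribute equally. -/
theorem derivation_trace_pow [Algebra ℂ R] (D : Derivation ℂ R R) (M : Matrix T T R) (b e : T)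
    (hD : ∀ x y, D (M x y) = if x = b ∧ y = e then 1 else 0) (n : ℕ) :
    D (M ^ n).trace = n * (M ^ (n - 1)) e b := by
  rw [Matrix.trace, map_sum]
  simp only [Matrix.diag_apply, derivation_pow_apply D M b e hD]
  rw [Finset.sum_comm]
  have : ∀ k ∈ Finset.range n, ∑ x, (M ^ k) x b * (M ^ (n - 1 - k)) e x = (M ^ (n - 1)) e b := by
    intro k hk
    have h : n - 1 = (n - 1 - k) + k := by have := Finset.mem_range.1 hk; omega
    conv_rhs => rw [h, pow_add, Matrix.mul_apply]
    exact Finset.sum_congr rfl fun _ _ => mul_comm _ _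
  rw [Finset.sum_congr rfl this]
  simp

end Matrices

/-- The chain rule for the evaluation of polynomials in `p_1, p_2, …`. -/
theorem derivation_aeval {R : Type*} [CommRing R] [Algebra ℂ R] (D : Derivation ℂ R R)
    (p : ℕ+ → R) (F : PRing) :
    D (MvPolynomial.aeval p F) =
      ∑ᶠ k, MvPolynomial.aeval p (MvPolynomial.pderiv k F) * D (p k) := by
  have hfin : ∀ F : PRing, (Function.support fun k =>
      MvPolynomial.aeval p (MvPolynomial.pderiv k F) * D (p k)).Finite := fun F =>
    F.vars.finite_toSet.subset fun k hk => by
      by_contra h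
      exact hk (by simp [MvPolynomial.pderiv_eq_zero_of_notMem_vars h])
  induction F using MvPolynomial.induction_on with
  | C c => simp
  | add F G hF hG =>
    simp only [map_add, hF, hG, add_mul]
    rw [finsum_add_distrib (hfin F) (hfin G)]
  | mul_X F n hF =>
    have h1 : ∀ k, MvPolynomial.aeval p (MvPolynomial.pderiv k (F * MvPolynomial.X n)) * D (p k) =
        p n * (MvPolynomial.aeval p (MvPolynomial.pderiv k F) * D (p k)) +
        (if k = n then MvPolynomial.aeval p F * D (p n) else 0) := by
      intro k
      rw [MvPolynomial.pderiv_mul]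
      by_cases h : k = n
      · subst h
        simp
        ring
      · simp [h, MvPolynomial.pderiv_X_of_ne (Ne.symm h)]
        ring
    rw [finsum_congr h1, finsum_add_distrib, ← mul_finsum' _ _ (hfin F), ← hF]
    · rw [finsum_eq_single _ n (by intro k hk; simp [hk])]
      simp
      ring
    · exact (hfin F).subset fun k hk h => hk (by
        dsimp only at h ⊢
        rw [h, mul_zero])
    · exact (Set.finite_singleton n).subset fun k hk => by
        by_contra h
        exact hk (if_neg h)

end WOperator

namespace WOperator

open Equiv.Perm (decomposeFin)

/-! ### Sums over tuples of positive integers -/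

theorem finsum_eq_finsum_comp_of_support_subset {α β M : Type*} [AddCommMonoid M] {f : β → M}
    {e : α → β} (he : Function.Injective e) (hf : Function.support f ⊆ Set.range e) :
    ∑ᶠ y, f y = ∑ᶠ x, f (e x) := by
  rw [← finsum_mem_range he, ← finsum_mem_univ]
  exact finsum_mem_inter_support_eq' _ _ _ fun x hx => ⟨fun _ => hf hx, fun _ => trivial⟩

theorem finsum_fin_succ_pi {d : ℕ} {M : Type*} [AddCommMonoid M] {g : (Fin (d + 1) → ℕ+) → M}
    (hg : (Function.support g).Finite) :
    ∑ᶠ a, g a = ∑ᶠ (a : Fin d → ℕ+) (x : ℕ+), g (Fin.cons x a) := by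
  let ε : (Fin d → ℕ+) × ℕ+ ≃ (Fin (d + 1) → ℕ+) :=
    (Equiv.prodComm _ _).trans (Fin.consEquiv fun _ => ℕ+)
  rw [← finsum_comp_equiv ε, finsum_curry]
  · rfl
  · exact hg.preimage ε.injective.injOn

/-- Merging the entry at 0 into the entry at `i.succ` is reversible once the part split off is
remembered. This matches the cutting of a matrix power by a derivative. -/
theorem finsum_fin_succ_pi_split {d : ℕ} {M : Type*} [AddCommMonoid M]
    {g : (Fin (d + 1) → ℕ+) → M} (hg : (Function.support g).Finite) (i : Fin d) :
    ∑ᶠ a, g a = ∑ᶠ a : Fin d → ℕ+, ∑ k ∈ Finset.range (a i - 1),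
      g (Fin.cons k.succPNat (Function.update a i (a i - k.succPNat))) := by
  classical
  -- Extension by zero: only a part strictly smaller than the whole leaves a positive remainder.
  let f : (Fin d → ℕ+) × ℕ+ → M := fun q =>
    if q.2 < q.1 i then g (Fin.cons q.2 (Function.update q.1 i (q.1 i - q.2))) else 0
  let ψ : (Fin (d + 1) → ℕ+) → (Fin d → ℕ+) × ℕ+ := fun a =>
    (Function.update (Fin.tail a) i (a 0 + a i.succ), a 0)
  have hfψ : ∀ a, f (ψ a) = g a := by
    intro a
    have h1 : a 0 < a 0 + a i.succ := PNat.lt_add_right _ _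
    have h2 : a 0 + a i.succ - a 0 = a i.succ := by rw [add_comm, PNat.add_sub]
    simp only [f, ψ, Function.update_self, if_pos h1, h2, Function.update_idem]
    congr 1
    have h3 : Function.update (Fin.tail a) i (a i.succ) = Fin.tail a :=
      Function.update_eq_self i (Fin.tail a)
    rw [h3, Fin.cons_self_tail]
  have hψ : Function.Injective ψ := by
    intro a b h
    have h0 : a 0 = b 0 := congrArg Prod.snd h
    have ht := congrArg Prod.fst h
    funext j
    cases j using Fin.cases with
    | zero => exact h0
    | succ j =>
      have hj := congrFun ht j
      by_cases hji : j = i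
      · subst hji
        simpa [ψ, h0] using hj
      · simpa [ψ, hji, Fin.tail] using hj
  have hf : Function.support f ⊆ Set.range ψ := by
    rintro ⟨a, x⟩ hq
    have hlt : x < a i := by
      by_contra h
      exact hq (if_neg h)
    refine ⟨Fin.cons x (Function.update a i (a i - x)), ?_⟩
    have : x + (a i - x) = a i := PNat.add_sub_of_lt hlt
    have h0 : (Fin.cons x (Function.update a i (a i - x)) : Fin (d + 1) → ℕ+) 0 = x := rfl
    have h1 : (Fin.cons x (Function.update a i (a i - x)) : Fin (d + 1) → ℕ+) i.succ = a i - x := by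
      rw [Fin.cons_succ, Function.update_self]
    simp only [ψ]
    rw [h0, h1, Fin.tail_cons, Function.update_idem, this, Function.update_eq_self]
  have hffin : (Function.support f).Finite := by
    refine (hg.image ψ).subset fun q hq => ?_
    obtain ⟨a, rfl⟩ := hf hq
    exact ⟨a, by rwa [Function.mem_support, ← hfψ], rfl⟩
  rw [← finsum_congr hfψ, ← finsum_eq_finsum_comp_of_support_subset hψ hf, finsum_curry _ hffin]
  refine finsum_congr fun a => ?_
  rw [finsum_eq_sum_of_support_subset (s := Finset.Iio (a i))]
  · symm
    refine Finset.sum_bij' (fun k _ => k.succPNat) (fun x _ => x.natPred) ?_ ?_ ?_ ?_ ?_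
    · intro k hk
      rw [Finset.mem_Iio, ← PNat.coe_lt_coe, Nat.succPNat_coe]
      have := Finset.mem_range.1 hk
      omega
    · intro x hx
      rw [Finset.mem_Iio, ← PNat.coe_lt_coe] at hx
      rw [Finset.mem_range, PNat.natPred]
      have := x.pos
      omega
    · simp
    · simp
    · intro k hk
      have : k.succPNat < a i := by
        rw [← PNat.coe_lt_coe, Nat.succPNat_coe]
        have := Finset.mem_range.1 hk
        omega
      simp [f, this]
  · intro x hx
    by_contra h
    exact hx (if_neg (by simpa using h))

/-! ### Derivatives of polynomials in the traces -/

section Traces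

variable {R T : Type*} [CommRing R] [Algebra ℂ R]

theorem derivation_prod (D : Derivation ℂ R R) {ι : Type*} [DecidableEq ι] (s : Finset ι)
    (f : ι → R) : D (∏ i ∈ s, f i) = ∑ i ∈ s, D (f i) * ∏ j ∈ s.erase i, f j := by
  induction s using Finset.induction_on with
  | empty => simp
  | insert i s hi ih =>
    rw [Finset.prod_insert hi, Derivation.leibniz, ih, Finset.sum_insert hi,
      Finset.erase_insert hi, smul_eq_mul, smul_eq_mul, Finset.mul_sum, add_comm, mul_comm]
    congr 1
    refine Finset.sum_congr rfl fun j hj => ?_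
    have hij : j ≠ i := fun h => hi (h ▸ hj)
    rw [Finset.erase_insert_of_ne hij.symm, Finset.prod_insert (fun h => hi (Finset.mem_of_mem_erase h))]
    ring

variable [Fintype T] [DecidableEq T]

/-- The evaluation of a polynomial in `p_1, p_2, …` at the traces of the powers of a matrix. -/
noncomputable def evalTrace (M : Matrix T T R) : PRing →ₐ[ℂ] R :=
  MvPolynomial.aeval fun k : ℕ+ => (M ^ (k : ℕ)).trace

/-- The factor k from differentiating tr M^k is absorbed into `scaledD k`. -/
theorem derivation_evalTrace (D : Derivation ℂ R R) (M : Matrix T T R) (b e : T)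
    (hD : ∀ x y, D (M x y) = if x = b ∧ y = e then 1 else 0) (F : PRing) :
    D (evalTrace M F) = ∑ᶠ k : ℕ+, (M ^ (k - 1 : ℕ)) e b * evalTrace M (scaledD k F) := by
  rw [evalTrace, derivation_aeval]
  refine finsum_congr fun k => ?_
  rw [derivation_trace_pow D M b e hD, scaledD, LinearMap.smul_apply, map_smul, Algebra.smul_def]
  simp
  ring

theorem finite_support_mul_evalTrace_dHat (M : Matrix T T R) {d : ℕ} (δ : Equiv.Perm (Fin d))
    (c : (Fin d → ℕ+) → R) (F : PRing) :
    (Function.support fun a => c a * evalTrace M (dHat δ a F)).Finite :=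
  (finite_dHat_ne_zero δ F).subset fun a ha h0 => ha (by
    dsimp only
    rw [h0, map_zero, mul_zero])

/-- The iterated derivative of a polynomial in the traces of the powers of a matrix. -/
theorem prod_derivation_evalTrace (D : T → T → Derivation ℂ R R) (M : Matrix T T R)
    (hD : ∀ b e x y, D b e (M x y) = if x = b ∧ y = e then 1 else 0) (F : PRing) {d : ℕ}
    (b e : Fin d → T) :
    (List.ofFn fun i => ((D (b i) (e i)).toLinearMap : Module.End ℂ R)).prod (evalTrace M F) =
      ∑ δ : Equiv.Perm (Fin d), ∑ᶠ a : Fin d → ℕ+,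
        (∏ i, (M ^ (a i - 1 : ℕ)) (e (δ i)) (b i)) * evalTrace M (dHat δ a F) := by
  induction d with
  | zero => simp [dHat_eq_scaledDs, finsum_eq_sum_of_fintype]
  | succ d ih =>
    rw [List.ofFn_succ, List.prod_cons, Module.End.mul_apply,
      ih (fun i => b i.succ) (fun i => e i.succ), map_sum, sum_perm_fin_succ]
    refine Finset.sum_congr rfl fun δ _ => ?_
    have hmap := AddMonoidHom.map_finsum
      ((D (b 0) (e 0)).toLinearMap : Module.End ℂ R).toAddMonoidHom
        (finite_support_mul_evalTrace_dHat M δ (fun a =>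
          ∏ i, (M ^ (a i - 1 : ℕ)) (e (δ i).succ) (b i.succ)) F)
    have hA : ∀ (x : ℕ+) (a : Fin d → ℕ+),
        dHat (decomposeFin.symm (0, δ)) (Fin.cons x a) F = scaledD x (dHat δ a F) := by
      intro x a
      rw [dHat_eq_scaledDs, cycleSums_decomposeFin_zero, scaledDs_cons, Module.End.mul_apply,
        ← dHat_eq_scaledDs]
    have hlt : ∀ (a : Fin d → ℕ+) (i : Fin d) (k : ℕ), k ∈ Finset.range (a i - 1) →
        k.succPNat < a i := by
      intro a i k hk
      rw [← PNat.coe_lt_coe, Nat.succPNat_coe]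
      have := Finset.mem_range.1 hk
      omega
    -- Cutting a matrix entry leaves the cycle sums, hence the operator on the polynomial,
    -- unchanged.
    have hB : ∀ (a : Fin d → ℕ+) (i : Fin d) (k : ℕ), k ∈ Finset.range (a i - 1) →
        dHat (decomposeFin.symm ((δ i).succ, δ))
          (Fin.cons k.succPNat (Function.update a i (a i - k.succPNat))) F = dHat δ a F := by
      intro a i k hk
      rw [dHat_eq_scaledDs, cycleSums_decomposeFin_succ, Function.update_self,
        Function.update_idem, PNat.add_sub_of_lt (hlt a i k hk), Function.update_eq_self,
        ← dHat_eq_scaledDs]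
    refine hmap.trans ?_
    rw [finsum_fin_succ_pi (finite_support_mul_evalTrace_dHat M _ _ F),
      Finset.sum_congr rfl fun i _ =>
        finsum_fin_succ_pi_split (finite_support_mul_evalTrace_dHat M _ _ F) i,
      ← finsum_sum_comm, ← finsum_add_distrib]
    · refine finsum_congr fun a => ?_
      change D (b 0) (e 0) (_ * _) = _
      rw [Derivation.leibniz, smul_eq_mul, smul_eq_mul,
        derivation_evalTrace (D (b 0) (e 0)) M (b 0) (e 0) (hD _ _)]
      -- The first summand of the Leibniz rule is the fixed-point case, the second the insertion
      -- case.
      congr 1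
      · rw [mul_finsum']
        · refine finsum_congr fun x => ?_
          simp only [hA, Fin.prod_univ_succ, Equiv.Perm.decomposeFin_symm_apply_zero,
            Fin.cons_zero, Fin.cons_succ, decomposeFin_symm_zero_succ]
          ring
        · refine (dHat δ a F).vars.finite_toSet.subset fun x hx => ?_
          by_contra h
          exact hx (by simp [scaledD, MvPolynomial.pderiv_eq_zero_of_notMem_vars h])
      · rw [derivation_prod, Finset.mul_sum]
        refine Finset.sum_congr rfl fun i _ => ?_
        rw [derivation_pow_apply (D (b 0) (e 0)) M (b 0) (e 0) (hD _ _), Finset.sum_mul,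
          Finset.mul_sum]
        refine Finset.sum_congr rfl fun k hk => ?_
        have hprod : ∏ j ∈ Finset.univ.erase i, (M ^ (a j - 1 : ℕ)) (e (δ j).succ) (b j.succ) =
            ∏ j ∈ Finset.univ.erase i,
              (M ^ ((Function.update a i (a i - k.succPNat) j : ℕ+) - 1 : ℕ))
                (e (decomposeFin.symm ((δ i).succ, δ) j.succ)) (b j.succ) := by
          refine Finset.prod_congr rfl fun j hj => ?_
          have hj := Finset.ne_of_mem_erase hj
          rw [Function.update_of_ne hj, decomposeFin_symm_succ_of_ne δ hj]
        -- An exponent is one less than its label: the left piece M^k has label k + 1, and the right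
        -- piece has the rest of `a i`.
        have hsub : ((a i - k.succPNat : ℕ+) - 1 : ℕ) = a i - 1 - 1 - k := by
          rw [PNat.sub_coe, if_pos (hlt a i k hk), Nat.succPNat_coe]
          omega
        rw [hB a i k hk, Fin.prod_univ_succ, hprod]
        simp only [Fin.cons_zero, Fin.cons_succ]
        rw [← Finset.mul_prod_erase Finset.univ _ (Finset.mem_univ i),
          decomposeFin_symm_succ_self, Equiv.Perm.decomposeFin_symm_apply_zero,
          Function.update_self, hsub, Nat.succPNat_coe, Nat.succ_sub_one]
        ring
    · refine (finite_dHat_ne_zero δ F).subset fun a ha h0 => ha ?_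
      simp only [hA, h0, map_zero, mul_zero, finsum_zero]
    · refine (finite_dHat_ne_zero δ F).subset fun a ha h0 => ha ?_
      refine Finset.sum_eq_zero fun i _ => Finset.sum_eq_zero fun k hk => ?_
      rw [hB a i k hk, h0, map_zero, mul_zero]
    · refine fun i _ => (finite_dHat_ne_zero δ F).subset fun a ha h0 => ha ?_
      refine Finset.sum_eq_zero fun k hk => ?_
      rw [hB a i k hk, h0, map_zero, mul_zero]

end Traces

end WOperator

namespace WOperator

open Equiv.Perm (decomposeFin)

/-! ### Setting variables to zero -/

open Classical in
/-- The power series obtained from `F` by setting all variables outside `S` to zero. -/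
noncomputable def restrictFun (S : Set (ℕ+ × ℕ+)) (F : MatSeries) : MatSeries :=
  fun m => if (m.support : Set (ℕ+ × ℕ+)) ⊆ S then MvPowerSeries.coeff m F else 0

open Classical in
theorem coeff_restrictFun (S : Set (ℕ+ × ℕ+)) (F : MatSeries) (m : ℕ+ × ℕ+ →₀ ℕ) :
    MvPowerSeries.coeff m (restrictFun S F) =
      if (m.support : Set (ℕ+ × ℕ+)) ⊆ S then MvPowerSeries.coeff m F else 0 := rfl

theorem coe_support_add_subset_iff {σ : Type*} (S : Set σ) (m n : σ →₀ ℕ) :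
    ((m + n).support : Set σ) ⊆ S ↔ (m.support : Set σ) ⊆ S ∧ (n.support : Set σ) ⊆ S := by
  classical
  rw [Finsupp.support_add_eq_union, Finset.coe_union, Set.union_subset_iff]

/-- The algebra endomorphism of `ℂ[[X_{ab}]]` that sets all variables outside `S` to zero. -/
noncomputable def restrict (S : Set (ℕ+ × ℕ+)) : MatSeries →ₐ[ℂ] MatSeries where
  toFun := restrictFun S
  map_zero' := by
    ext m
    simp [coeff_restrictFun]
  map_add' F G := by
    ext m
    simp only [coeff_restrictFun, map_add]
    split_ifs <;> simp
  map_one' := by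
    classical
    ext m
    by_cases h : m = 0 <;> simp [coeff_restrictFun, MvPowerSeries.coeff_one, h]
  map_mul' F G := by
    classical
    ext m
    simp only [coeff_restrictFun, MvPowerSeries.coeff_mul]
    have key : ∀ q ∈ Finset.HasAntidiagonal.antidiagonal m,
        (if (q.1.support : Set (ℕ+ × ℕ+)) ⊆ S then MvPowerSeries.coeff q.1 F else 0) *
          (if (q.2.support : Set (ℕ+ × ℕ+)) ⊆ S then MvPowerSeries.coeff q.2 G else 0) =
        if (m.support : Set (ℕ+ × ℕ+)) ⊆ S then
          MvPowerSeries.coeff q.1 F * MvPowerSeries.coeff q.2 G else 0 := by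
      intro q hq
      rw [← Finset.HasAntidiagonal.mem_antidiagonal.1 hq, coe_support_add_subset_iff, ite_zero_mul_ite_zero]
      congr
    rw [Finset.sum_congr rfl key]
    split_ifs <;> simp
  commutes' c := by
    classical
    ext m
    by_cases h : m = 0 <;>
      simp [coeff_restrictFun, MvPowerSeries.algebraMap_apply, MvPowerSeries.coeff_C, h]

open Classical in
theorem coeff_restrict (S : Set (ℕ+ × ℕ+)) (F : MatSeries) (m : ℕ+ × ℕ+ →₀ ℕ) :
    MvPowerSeries.coeff m (restrict S F) =
      if (m.support : Set (ℕ+ × ℕ+)) ⊆ S then MvPowerSeries.coeff m F else 0 := rfl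

theorem restrict_entry_of_mem {S : Set (ℕ+ × ℕ+)} {a b : ℕ+} (h : (a, b) ∈ S) :
    restrict S (entry a b) = entry a b := by
  classical
  ext m
  rw [coeff_restrict, entry, MvPowerSeries.coeff_X, ite_eq_left_iff]
  intro hm
  rw [if_neg]
  rintro rfl
  refine hm fun q hq => ?_
  have : q = (a, b) := by simpa using hq
  rwa [this]

theorem restrict_entry_of_notMem {S : Set (ℕ+ × ℕ+)} {a b : ℕ+} (h : (a, b) ∉ S) :
    restrict S (entry a b) = 0 := by
  classical
  ext m
  rw [coeff_restrict, entry, MvPowerSeries.coeff_X]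
  split_ifs with h1 h2
  · subst h2
    exact absurd (h1 (by simp)) h
  all_goals simp

/-- A monomial involves finitely many row and column indices, so its coefficient survives for a
suitable `T`. -/
theorem eq_of_forall_restrict_eq {F G : MatSeries}
    (h : ∀ T : Finset ℕ+, restrict ((T : Set ℕ+) ×ˢ (T : Set ℕ+)) F =
      restrict ((T : Set ℕ+) ×ˢ (T : Set ℕ+)) G) : F = G := by
  classical
  ext m
  have := congrArg (MvPowerSeries.coeff m) (h (m.support.image Prod.fst ∪ m.support.image Prod.snd))
  rw [coeff_restrict, coeff_restrict, if_pos, if_pos] at this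
  · exact this
  all_goals
    intro q hq
    have h1 := Finset.mem_image_of_mem Prod.fst hq
    have h2 := Finset.mem_image_of_mem Prod.snd hq
    exact ⟨by simp only [Finset.coe_union]; exact Or.inl h1,
      by simp only [Finset.coe_union]; exact Or.inr h2⟩

/-- If only finitely many members of a family survive setting variables to zero, the image of its
sum is a finite sum. -/
theorem restrict_formalSum (S : Set (ℕ+ × ℕ+)) {I J : Type*} [Fintype J] (f : I → MatSeries)
    {g : J → I} (hg : Function.Injective g) (hf : ∀ i ∉ Set.range g, restrict S (f i) = 0) :
    restrict S (formalSum f) = ∑ j, restrict S (f (g j)) := by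
  ext m
  rw [coeff_restrict, map_sum, coeff_formalSum]
  simp only [coeff_restrict]
  split_ifs with h
  · rw [finsum_eq_finsum_comp_of_support_subset hg, finsum_eq_sum_of_fintype]
    intro i hi
    by_contra hir
    apply hi
    have := congrArg (MvPowerSeries.coeff m) (hf i hir)
    rwa [coeff_restrict, if_pos h, map_zero] at this
  · simp

theorem restrict_formalSum_eq_zero (S : Set (ℕ+ × ℕ+)) {I : Type*} (f : I → MatSeries)
    (hf : ∀ i, restrict S (f i) = 0) : restrict S (formalSum f) = 0 := by
  rw [restrict_formalSum S f (J := Empty) (g := Empty.elim) (fun x => x.elim) fun i _ => hf i]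
  simp

/-- Multiplying a monomial by a variable in `S` does not change whether it is supported in `S`. -/
theorem restrict_dEntry {S : Set (ℕ+ × ℕ+)} {a b : ℕ+} (h : (a, b) ∈ S) (F : MatSeries) :
    restrict S (dEntry a b F) = dEntry a b (restrict S F) := by
  classical
  ext m
  change _ = MvPowerSeries.coeff m (MvPowerSeries.pderiv ℂ (a, b) _)
  rw [coeff_restrict, MvPowerSeries.coeff_pderiv, coeff_restrict]
  change (if _ then MvPowerSeries.coeff m (MvPowerSeries.pderiv ℂ (a, b) _) else 0) = _
  rw [MvPowerSeries.coeff_pderiv]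
  have : (((m + Finsupp.single (a, b) 1).support : Finset _) : Set (ℕ+ × ℕ+)) ⊆ S ↔
      (m.support : Set (ℕ+ × ℕ+)) ⊆ S := by
    constructor
    · intro hs q hq
      apply hs
      simp only [Finset.mem_coe, Finsupp.mem_support_iff, Finsupp.add_apply] at hq ⊢
      omega
    · intro hs q hq
      by_cases hqa : q = (a, b)
      · rwa [hqa]
      · apply hs
        simpa [Finsupp.single_apply, Ne.symm hqa] using hq
  simp only [this]
  split_ifs <;> simp

theorem dEntries_eq_prod {d : ℕ} (b e : Fin d → ℕ+) :
    dEntries b e = (List.ofFn fun i => dEntry (b i) (e i)).prod := by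
  simp [dEntries, Finset.noncommProd, Fin.univ_val_map]

theorem restrict_dEntries {S : Set (ℕ+ × ℕ+)} {d : ℕ} {b e : Fin d → ℕ+}
    (h : ∀ i, (b i, e i) ∈ S) (F : MatSeries) :
    restrict S (dEntries b e F) = dEntries b e (restrict S F) := by
  rw [dEntries_eq_prod]
  refine LinearMap.congr_fun (Commute.list_prod_right
    (List.ofFn fun i => dEntry (b i) (e i)) ((restrict S).toLinearMap : Module.End ℂ MatSeries)
      fun x hx => ?_) F
  obtain ⟨i, rfl⟩ := (List.mem_ofFn' _ _).1 hx
  exact LinearMap.ext (restrict_dEntry (h i))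

theorem restrict_prod_entry_mul_of_notMem {S : Set (ℕ+ × ℕ+)} {d : ℕ} {a b : Fin d → ℕ+}
    {i : Fin d} (h : (a i, b i) ∉ S) (F : MatSeries) :
    restrict S ((∏ i, entry (a i) (b i)) * F) = 0 := by
  rw [map_mul, map_prod, Finset.prod_eq_zero (Finset.mem_univ i) (restrict_entry_of_notMem h),
    zero_mul]

theorem restrict_prod_entry {S : Set (ℕ+ × ℕ+)} {d : ℕ} {a b : Fin d → ℕ+}
    (h : ∀ i, (a i, b i) ∈ S) :
    restrict S (∏ i, entry (a i) (b i)) = ∏ i, entry (a i) (b i) := by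
  rw [map_prod]
  exact Finset.prod_congr rfl fun i _ => restrict_entry_of_mem (h i)

theorem injective_coe_comp {d : ℕ} (T : Finset ℕ+) :
    Function.Injective fun (α : Fin d → T) i => (α i : ℕ+) :=
  fun _ _ h => funext fun i => Subtype.ext (congrFun h i)

theorem exists_notMem_of_notMem_range {d : ℕ} {T : Finset ℕ+} {a : Fin d → ℕ+}
    (h : a ∉ Set.range fun (α : Fin d → T) i => (α i : ℕ+)) : ∃ i, a i ∉ T := by
  by_contra! hall
  exact h ⟨fun i => ⟨a i, hall i⟩, rfl⟩

/-- After setting to zero all variables outside a finite square matrix, `W([d])` is given by a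
finite sum. -/
theorem restrict_W (T : Finset ℕ+) (d : ℕ) (F : MatSeries) :
    restrict ((T : Set ℕ+) ×ˢ (T : Set ℕ+)) (W d F) = (d : ℂ)⁻¹ •
      ∑ α : Fin d → T, ∑ e : Fin d → T, (∏ i, entry (α i) (e i)) *
        dEntries (fun i => (α (finRotate d i) : ℕ+)) (fun i => (e i : ℕ+))
          (restrict ((T : Set ℕ+) ×ˢ (T : Set ℕ+)) F) := by
  change restrict _ ((d : ℂ)⁻¹ • formalSum fun a : Fin d → ℕ+ => cycD a F) = _
  rw [map_smul, restrict_formalSum _ _ (injective_coe_comp T)]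
  · congr 1
    refine Finset.sum_congr rfl fun α _ => ?_
    change restrict _ (formalSum _) = _
    rw [restrict_formalSum _ _ (injective_coe_comp T)]
    · refine Finset.sum_congr rfl fun e _ => ?_
      -- Once the factors X_{a_i e_i} have forced all indices into `T`, the derivatives use only
      -- variables that are kept.
      rw [map_mul, restrict_prod_entry fun i => Set.mk_mem_prod (α i).2 (e i).2,
        restrict_dEntries fun i => Set.mk_mem_prod (α _).2 (e i).2]
    · intro e he
      obtain ⟨i, hi⟩ := exists_notMem_of_notMem_range he
      exact restrict_prod_entry_mul_of_notMem (i := i) (fun h => hi h.2) _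
  · intro a ha
    obtain ⟨i, hi⟩ := exists_notMem_of_notMem_range ha
    exact restrict_formalSum_eq_zero _ _ fun e =>
      restrict_prod_entry_mul_of_notMem (i := i) (fun h => hi h.1) _

/-! ### The generic finite matrix and the operator identity -/

/-- The generic matrix with rows and columns in a finite set of indices. -/
noncomputable def genericMatrix (T : Finset ℕ+) : Matrix T T MatSeries :=
  fun a b => entry a b

theorem exists_cycleSums_finRotate (n : ℕ) (a : Fin (n + 1) → ℕ+) :
    ∃ s : ℕ+, cycleSums (finRotate (n + 1)) a = {s} ∧ (s : ℕ) = ∑ i, (a i : ℕ) := by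
  induction n with
  | zero =>
    obtain ⟨x, a, rfl⟩ : ∃ x b, a = Fin.cons x b := ⟨a 0, Fin.tail a, (Fin.cons_self_tail a).symm⟩
    have h : finRotate (0 + 1) = decomposeFin.symm (0, 1) :=
      Subsingleton.elim (α := Equiv.Perm (Fin 1)) _ _
    refine ⟨x, ?_, by simp⟩
    rw [h, cycleSums_decomposeFin_zero, cycleSums_zero]
    rfl
  | succ n ih =>
    obtain ⟨x, a, rfl⟩ : ∃ x b, a = Fin.cons x b := ⟨a 0, Fin.tail a, (Fin.cons_self_tail a).symm⟩
    -- The longer rotation is the shorter one with a point inserted between this `i` and its image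
    -- 0.
    obtain ⟨i, hi⟩ := (finRotate (n + 1)).surjective 0
    obtain ⟨s, hs, hsum⟩ := ih (Function.update a i (x + a i))
    refine ⟨s, ?_, ?_⟩
    · rw [← hs, ← cycleSums_decomposeFin_succ, hi, finRotate_succ_eq_decomposeFin]
      rfl
    · rw [hsum, Fin.sum_univ_succ (n := n + 1), ← Finset.add_sum_erase _ _ (Finset.mem_univ i),
        ← Finset.add_sum_erase (a := i) _ _ (Finset.mem_univ i)]
      simp only [Function.update_self, Fin.cons_zero, Fin.cons_succ, PNat.add_coe, add_assoc]
      congr 2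
      refine Finset.sum_congr rfl fun j hj => ?_
      rw [Function.update_of_ne (Finset.ne_of_mem_erase hj)]

theorem trace_pow_eq_sum_cycle {R T : Type*} [CommRing R] [Fintype T] [DecidableEq T]
    (M : Matrix T T R) (k : ℕ+) :
    (M ^ (k : ℕ)).trace = ∑ α : Fin (k : ℕ) → T, ∏ i, M (α i) (α (finRotate k i)) := by
  obtain ⟨n, rfl⟩ : ∃ n : ℕ, k = n.succPNat := ⟨k.natPred, by simp⟩
  obtain ⟨s, hs, hsum⟩ := exists_cycleSums_finRotate n fun _ => 1
  -- The general formula has the successor as row index, hence the transpose.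
  have h := sum_prod_pow_eq_prod_trace M.transpose (finRotate (n + 1)) fun _ => 1
  rw [hs, Multiset.map_singleton, Multiset.prod_singleton, hsum] at h
  have ht : ∀ n : ℕ, (M.transpose ^ n).trace = (M ^ n).trace := fun n => by
    rw [← Matrix.transpose_pow, Matrix.trace_transpose]
  rw [ht] at h
  simp only [PNat.one_coe, pow_one, Matrix.transpose_apply, Finset.sum_const, Finset.card_univ,
    Fintype.card_fin, smul_eq_mul, mul_one] at h
  exact h.symm

theorem restrict_powerTrace (T : Finset ℕ+) (k : ℕ+) :
    restrict ((T : Set ℕ+) ×ˢ (T : Set ℕ+)) (powerTrace k) =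
      (genericMatrix T ^ (k : ℕ)).trace := by
  rw [trace_pow_eq_sum_cycle, powerTrace, restrict_formalSum _ _ (injective_coe_comp T)]
  · exact Finset.sum_congr rfl fun α _ => restrict_prod_entry fun i => Set.mk_mem_prod (α _).2 (α _).2
  · intro a ha
    obtain ⟨i, hi⟩ := exists_notMem_of_notMem_range ha
    rw [cycMonomial, ← mul_one (∏ i, _)]
    exact restrict_prod_entry_mul_of_notMem (i := i) (fun h => hi h.1) _

theorem restrict_toSeries (T : Finset ℕ+) (F : PRing) :
    restrict ((T : Set ℕ+) ×ˢ (T : Set ℕ+)) (toSeries F) = evalTrace (genericMatrix T) F := by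
  refine AlgHom.congr_fun (φ₁ := (restrict _).comp toSeries) ?_ F
  refine MvPolynomial.algHom_ext fun k => ?_
  change restrict _ (MvPolynomial.aeval powerTrace (MvPolynomial.X k)) =
    MvPolynomial.aeval _ (MvPolynomial.X k)
  rw [MvPolynomial.aeval_X, MvPolynomial.aeval_X, restrict_powerTrace]

theorem pderiv_genericMatrix (T : Finset ℕ+) (b e x y : T) :
    MvPowerSeries.pderiv ℂ ((b : ℕ+), (e : ℕ+)) (genericMatrix T x y) =
      if x = b ∧ y = e then 1 else 0 := by
  classical
  rw [genericMatrix, entry, MvPowerSeries.pderiv_X, Pi.single_apply]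
  simp only [Prod.mk.injEq, Subtype.ext_iff]

theorem evalTrace_pHat {R T : Type*} [CommRing R] [Algebra ℂ R] [Fintype T] [DecidableEq T]
    (M : Matrix T T R) {d : ℕ} (δ : Equiv.Perm (Fin d)) (a : Fin d → ℕ+) :
    evalTrace M (pHat δ a) =
      ((cycleSums δ a).map fun k : ℕ+ => (M ^ (k : ℕ)).trace).prod := by
  rw [pHat_eq_prod_cycleSums, map_multiset_prod, Multiset.map_map]
  simp [evalTrace, Function.comp_def]

theorem W_toSeries (d : ℕ) (F : PRing) : W d (toSeries F) = toSeries (Delta d F) := by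
  refine eq_of_forall_restrict_eq fun T => ?_
  rw [restrict_W, restrict_toSeries, restrict_toSeries]
  set M := genericMatrix T
  change _ = evalTrace M ((d : ℂ)⁻¹ • ∑ δ : Equiv.Perm (Fin d),
    ∑ᶠ a : Fin d → ℕ+, pHat (phi δ) a * dHat δ a F)
  rw [map_smul, map_sum]
  congr 1
  have hW : ∀ α e : Fin d → T, dEntries (fun i => (α (finRotate d i) : ℕ+))
      (fun i => (e i : ℕ+)) (evalTrace M F) = ∑ δ : Equiv.Perm (Fin d), ∑ᶠ a : Fin d → ℕ+,
        (∏ i, (M ^ (a i - 1 : ℕ)) (e (δ i)) (α (finRotate d i))) *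
          evalTrace M (dHat δ a F) := by
    intro α e
    rw [dEntries_eq_prod, ← prod_derivation_evalTrace (fun b e : T =>
      MvPowerSeries.pderiv ℂ ((b : ℕ+), (e : ℕ+))) M (pderiv_genericMatrix T) F
        (fun i => α (finRotate d i)) e]
    rfl
  have hfin := fun (δ : Equiv.Perm (Fin d)) => finite_support_mul_evalTrace_dHat M δ
  simp only [hW, Finset.mul_sum, mul_finsum, ← mul_assoc]
  rw [Finset.sum_congr rfl fun α _ => Finset.sum_comm, Finset.sum_comm]
  refine Finset.sum_congr rfl fun δ _ => ?_
  rw [Finset.sum_congr rfl fun α _ => (finsum_sum_comm _ _ fun e _ => hfin δ _ F).symm,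
    ← finsum_sum_comm]
  · have hmap := AddMonoidHom.map_finsum (evalTrace M : PRing →+ MatSeries)
      (finite_pHat_mul_dHat_ne_zero δ F)
    refine Eq.trans ?_ hmap.symm
    refine finsum_congr fun a => ?_
    change _ = evalTrace M (_ * _)
    rw [map_mul, evalTrace_pHat, ← sum_sum_prod_eq_prod_trace, Finset.sum_mul]
    simp only [Finset.sum_mul]
    rfl
  · refine fun α _ => (finite_dHat_ne_zero δ F).subset fun a ha h0 => ha ?_
    simp [h0]

end WOperator

namespace WOperator

/-! ### Algebraic independence of the traces -/

/-- The evaluation of a polynomial in `p_1, p_2, …` at the power sums of the variables `X_{ii}`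
with `i ∈ T`. -/
noncomputable def evalPsum (T : Finset ℕ+) : PRing →ₐ[ℂ] MatSeries :=
  MvPolynomial.aeval fun k : ℕ+ => ∑ i ∈ T, entry i i ^ (k : ℕ)

/-- The generic matrix becomes diagonal, and the trace of its k-th power a power sum. -/
theorem restrict_diagonal_toSeries (T : Finset ℕ+) (F : PRing) :
    restrict {q | q.1 = q.2} (restrict ((T : Set ℕ+) ×ˢ (T : Set ℕ+)) (toSeries F)) =
      evalPsum T F := by
  rw [restrict_toSeries]
  refine AlgHom.congr_fun (φ₁ := (restrict _).comp (evalTrace _)) ?_ F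
  refine MvPolynomial.algHom_ext fun k => ?_
  have hM : (genericMatrix T).map (restrict {q | q.1 = q.2}) =
      Matrix.diagonal fun i : T => entry i i := by
    ext1 i j
    by_cases h : i = j
    · subst h
      simpa [genericMatrix] using restrict_entry_of_mem (S := {q | q.1 = q.2}) rfl
    · rw [Matrix.diagonal_apply_ne _ h]
      exact restrict_entry_of_notMem fun h' => h (Subtype.ext h')
  have h1 : restrict {q | q.1 = q.2} (genericMatrix T ^ (k : ℕ)).trace =
      (((genericMatrix T).map (restrict {q | q.1 = q.2})) ^ (k : ℕ)).trace := by
    rw [← AlgHom.mapMatrix_apply, ← map_pow]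
    exact AddMonoidHom.map_trace (restrict {q | q.1 = q.2} : MatSeries →+ MatSeries) _
  simp only [AlgHom.comp_apply, evalTrace, evalPsum, MvPolynomial.aeval_X, h1, hM,
    Matrix.diagonal_pow, Matrix.trace_diagonal]
  exact Finset.sum_coe_sort T fun i => entry i i ^ (k : ℕ)

theorem pderiv_evalPsum {T : Finset ℕ+} {i : ℕ+} (hi : i ∈ T) (F : PRing) :
    MvPowerSeries.pderiv ℂ (i, i) (evalPsum T F) =
      ∑ᶠ k : ℕ+, evalPsum T (scaledD k F) * entry i i ^ (k - 1 : ℕ) := by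
  rw [evalPsum, derivation_aeval]
  refine finsum_congr fun k => ?_
  have h : MvPowerSeries.pderiv ℂ (i, i) (∑ j ∈ T, entry j j ^ (k : ℕ)) =
      (k : ℕ) * entry i i ^ (k - 1 : ℕ) := by
    rw [map_sum, Finset.sum_eq_single_of_mem i hi]
    · simp [entry]
    · intro j _ hj
      simp [entry, hj]
  rw [h, scaledD, LinearMap.smul_apply, map_smul, Algebra.smul_def]
  simp
  ring

theorem entry_diagonal_injective : Function.Injective fun i : ℕ+ => entry i i := by
  intro i j h
  have := (MvPowerSeries.X_inj).1 h
  exact congrArg Prod.fst this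

/-- If a polynomial in `p_1, p_2, …` vanishes at the power sums of many variables, then so do its
partial derivatives. -/
theorem evalPsum_scaledD_eq_zero {T : Finset ℕ+} {F : PRing} (h : evalPsum T F = 0)
    (hT : ∀ k ∈ F.vars, (k : ℕ) ≤ T.card) (k : ℕ+) : evalPsum T (scaledD k F) = 0 := by
  by_cases hk : k ∈ F.vars
  swap
  · simp [scaledD, MvPolynomial.pderiv_eq_zero_of_notMem_vars hk]
  have : IsDomain MatSeries := NoZeroDivisors.to_isDomain _
  -- By `pderiv_evalPsum`, each X_{ii} with i in `T` is a root of `q`; the roots are distinct and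
  -- outnumber its degree.
  let q : Polynomial MatSeries :=
    ∑ k ∈ F.vars, Polynomial.monomial (k - 1 : ℕ) (evalPsum T (scaledD k F))
  have hq : q = 0 := by
    refine Polynomial.eq_zero_of_natDegree_lt_card_of_eval_eq_zero' q
      (T.map ⟨_, entry_diagonal_injective⟩) ?_ ?_
    · intro x hx
      obtain ⟨i, hi, rfl⟩ := Finset.mem_map.1 hx
      have h1 := pderiv_evalPsum hi F
      rw [h, map_zero, finsum_eq_sum_of_support_subset (s := F.vars)] at h1
      · simp only [q, Polynomial.eval_finsetSum, Polynomial.eval_monomial]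
        exact h1.symm
      · intro k hk
        by_contra hk'
        exact hk (by simp [scaledD, MvPolynomial.pderiv_eq_zero_of_notMem_vars hk'])
    · rw [Finset.card_map]
      have hpos : 0 < T.card := k.pos.trans_le (hT k hk)
      refine lt_of_le_of_lt (Polynomial.natDegree_sum_le_of_forall_le (n := T.card - 1) _ _
        fun k hk => (Polynomial.natDegree_monomial_le _).trans ?_) (by omega)
      have := hT k hk
      omega
  have hc := congrArg (fun q => Polynomial.coeff q (k - 1 : ℕ)) hq
  simp only [q, Polynomial.finsetSum_coeff, Polynomial.coeff_monomial, Polynomial.coeff_zero] at hc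
  rw [Finset.sum_eq_single_of_mem k hk] at hc
  · simpa using hc
  · intro j _ hj
    refine if_neg fun hjk => hj (PNat.eq ?_)
    have := j.pos
    have := k.pos
    omega

theorem constantCoeff_evalPsum (T : Finset ℕ+) (F : PRing) :
    MvPowerSeries.constantCoeff (evalPsum T F) = MvPolynomial.constantCoeff F := by
  refine RingHom.congr_fun (f := MvPowerSeries.constantCoeff.comp (evalPsum T : PRing →+* MatSeries))
    ?_ F
  refine MvPolynomial.ringHom_ext (fun c => ?_) fun k => ?_
  · simp [evalPsum, MvPowerSeries.algebraMap_apply]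
  · simp [evalPsum, entry]

theorem coeff_eq_zero_of_evalPsum_eq_zero (n : ℕ) : ∀ (m : ℕ+ →₀ ℕ), m.degree = n →
    ∀ (F : PRing) (N : ℕ), (∀ T : Finset ℕ+, N ≤ T.card → evalPsum T F = 0) →
      MvPolynomial.coeff m F = 0 := by
  induction n with
  | zero =>
    intro m hm F N hF
    rw [Finsupp.degree_eq_zero_iff] at hm
    obtain ⟨T, hT⟩ := Infinite.exists_subset_card_eq ℕ+ N
    rw [hm]
    change MvPolynomial.constantCoeff F = 0
    rw [← constantCoeff_evalPsum T, hF T hT.ge, map_zero]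
  | succ n ih =>
    intro m hm F N hF
    obtain ⟨k, hk⟩ : ∃ k, m k ≠ 0 := by
      by_contra! h
      have : m = 0 := Finsupp.ext h
      simp [this] at hm
    have hle : Finsupp.single k 1 ≤ m := by
      rw [Finsupp.single_le_iff]
      omega
    obtain ⟨m', rfl⟩ := exists_add_of_le hle
    rw [map_add, Finsupp.degree_single] at hm
    -- The threshold is raised so that `T` has at least as many elements as the largest index of a
    -- variable of `F`.
    have h := ih m' (by omega) (scaledD k F) (max N (F.vars.sup fun k => (k : ℕ))) fun T hT =>
      evalPsum_scaledD_eq_zero (hF T ((le_max_left _ _).trans hT)) (fun k hk =>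
        (Finset.le_sup (f := fun k : ℕ+ => (k : ℕ)) hk).trans ((le_max_right _ _).trans hT)) k
    rw [scaledD, LinearMap.smul_apply, MvPolynomial.coeff_smul] at h
    change _ • MvPolynomial.coeff m' (MvPolynomial.pderiv k F) = 0 at h
    rw [MvPolynomial.coeff_pderiv, smul_eq_mul, add_comm] at h
    have h1 : ((k : ℕ) : ℂ) ≠ 0 := Nat.cast_ne_zero.2 k.ne_zero
    have h2 : ((m' k : ℂ) + 1) ≠ 0 := Nat.cast_add_one_ne_zero _
    simpa [h1, h2] using h

theorem algebraicIndependent_powerTrace : AlgebraicIndependent ℂ powerTrace := by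
  rw [algebraicIndependent_iff]
  intro F hF
  ext m
  refine coeff_eq_zero_of_evalPsum_eq_zero _ m rfl F 0 fun T _ => ?_
  rw [← restrict_diagonal_toSeries, toSeries, hF, map_zero, map_zero]

end WOperator

/-- The power series `p_k = tr(X^k)`, `k ≥ 1`, are algebraically independent, so that
`ℂ[p_1, p_2, …]` is a subring of `ℂ[[X_{ab}]]`; and for every element `F` of it,
`W([d]) F = Δ_d F`. -/
theorem theorem316 (d : ℕ) (hd : 0 < d) :
    AlgebraicIndependent ℂ WOperator.powerTrace ∧
      ∀ F : WOperator.PRing,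
        WOperator.W d (WOperator.toSeries F) = WOperator.toSeries (WOperator.Delta d F) := by
  exact ⟨WOperator.algebraicIndependent_powerTrace, WOperator.W_toSeries d⟩
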